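/- Let $p$ be a prime, let $k$ be a field of characteristic $p$ and let $G$ be a finite $p$-group. Let $V_{reg}=\bigoplus_{g\in G}kX_g$ be the regular $kG$-module, with right $G$-action $X_g\cdot h=X_{gh}$, and let $$D_k=D_k(G)=\mathrm{Sym}_k(V_{reg})/(\alpha),\qquad \alpha=-1+\sum_{g\in G}X_g,$$ be the dehomogenized symmetric algebra, with the induced right action of $G$ by $k$-algebra automorphisms. Then the ring of invariants $$D_k^G=\{d\in D_k : d\cdot h=d \text{ for all } h\in G\}$$ is a polynomial ring over $k$ of Krull dimension $|G|-1$; that is, $D_k^G$ is isomorphic as a $k$-algebra to a polynomial ring over $k$ in $|G|-1$ variables, and its Krull dimension is $|G|-1$. -/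

import Mathlib

set_option linter.unusedSectionVars false

noncomputable section

namespace DehomSym

variable (k : Type*) [Field k] (G : Type*) [Group G]

/-- The vector space `V_reg = ⊕_{g ∈ G} k X_g` underlying the regular `kG`-module. The basis
vector `X_g` is `Finsupp.single g 1`. -/
abbrev Vreg : Type _ := G →₀ k

variable {G} in
/-- The element `X_g` of `Sym_k(V_reg)`. -/
def X (g : G) : SymmetricAlgebra k (Vreg k G) :=
  SymmetricAlgebra.ι k (Vreg k G) (Finsupp.single g 1)

variable {G} in
/-- The right regular action of `h` on `V_reg`: the linear map with `X_g ↦ X_{gh}`. -/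
def regularAct (h : G) : Vreg k G →ₗ[k] Vreg k G :=
  Finsupp.lmapDomain k k (fun g => g * h)

variable {G} in
/-- The `k`-algebra endomorphism of `Sym_k(V_reg)` induced by the right regular action of `h`. -/
def symAct (h : G) : SymmetricAlgebra k (Vreg k G) →ₐ[k] SymmetricAlgebra k (Vreg k G) :=
  SymmetricAlgebra.lift ((SymmetricAlgebra.ι k (Vreg k G)).comp (regularAct k h))

variable {G} in
theorem symAct_X (h g : G) : symAct k h (X k g) = X k (g * h) := by
  simp [symAct, X, regularAct]

variable {k G} in
/-- Algebra homomorphisms out of `Sym_k(V_reg)` are determined by their values on the `X_g`. -/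
theorem sym_hom_ext {A : Type*} [CommRing A] [Algebra k A]
    {f₁ f₂ : SymmetricAlgebra k (Vreg k G) →ₐ[k] A} (h : ∀ g, f₁ (X k g) = f₂ (X k g)) :
    f₁ = f₂ := by
  apply SymmetricAlgebra.algHom_ext
  apply Finsupp.lhom_ext'
  intro g
  apply LinearMap.ext_ring
  exact h g

section Fin

variable [Finite G]

/-- The element `α = -1 + ∑_{g ∈ G} X_g` of `Sym_k(V_reg)`. -/
def alpha : SymmetricAlgebra k (Vreg k G) := -1 + ∑ᶠ g : G, X k g

variable {G} in
theorem symAct_alpha (h : G) : symAct k h (alpha k G) = alpha k G := by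
  have := Fintype.ofFinite G
  simp only [alpha, finsum_eq_sum_of_fintype, map_add, map_neg, map_one, map_sum, symAct_X]
  congr 1
  exact Fintype.sum_equiv (Equiv.mulRight h) _ _ (fun _ => rfl)

/-- The dehomogenized symmetric algebra `D_k(G) = Sym_k(V_reg) / (α)`. -/
def D : Type _ := SymmetricAlgebra k (Vreg k G) ⧸ Ideal.span {alpha k G}

instance : CommRing (D k G) :=
  inferInstanceAs (CommRing (SymmetricAlgebra k (Vreg k G) ⧸ Ideal.span {alpha k G}))

instance : Algebra k (D k G) :=
  inferInstanceAs (Algebra k (SymmetricAlgebra k (Vreg k G) ⧸ Ideal.span {alpha k G}))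

/-- The quotient map `Sym_k(V_reg) → D_k(G)`. -/
def mk : SymmetricAlgebra k (Vreg k G) →ₐ[k] D k G :=
  Ideal.Quotient.mkₐ k (Ideal.span {alpha k G})

theorem mk_surjective : Function.Surjective (mk k G) :=
  Ideal.Quotient.mkₐ_surjective k _

theorem mk_alpha : mk k G (alpha k G) = 0 :=
  Ideal.Quotient.eq_zero_iff_mem.2 (Ideal.subset_span rfl)

variable {G} in
/-- The generator `x_g = X_g + (α)` of `D_k(G)`. -/
def x (g : G) : D k G := mk k G (X k g)

variable {k G} in
theorem D_hom_ext {A : Type*} [CommRing A] [Algebra k A]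
    {f₁ f₂ : D k G →ₐ[k] A} (h : ∀ g, f₁ (x k g) = f₂ (x k g)) : f₁ = f₂ := by
  have : f₁.comp (mk k G) = f₂.comp (mk k G) := sym_hom_ext h
  ext d
  obtain ⟨s, rfl⟩ := mk_surjective k G d
  exact DFunLike.congr_fun this s

variable {G} in
/-- The `k`-algebra endomorphism of `D_k(G)` induced by the right regular action of `h`. -/
def act (h : G) : D k G →ₐ[k] D k G :=
  Ideal.Quotient.liftₐ (Ideal.span {alpha k G}) ((mk k G).comp (symAct k h)) (by
    intro a ha
    have hle : Ideal.span {alpha k G} ≤ RingHom.ker ((mk k G).comp (symAct k h)) := by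
      rw [Ideal.span_singleton_le_iff_mem, RingHom.mem_ker, AlgHom.comp_apply,
        symAct_alpha, mk_alpha]
    exact hle ha)

variable {G} in
theorem act_mk (h : G) (s : SymmetricAlgebra k (Vreg k G)) :
    act k h (mk k G s) = mk k G (symAct k h s) := rfl

variable {G} in
theorem act_x (h g : G) : act k h (x k g) = x k (g * h) := by
  rw [x, act_mk, symAct_X, x]

/-- The right action of `G` on `D_k(G)` by ring automorphisms, `x_g · h = x_{gh}`, as a left action
of the opposite group. -/
instance : MulSemiringAction Gᵐᵒᵖ (D k G) where
  smul h d := act k h.unop d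
  one_smul d := by
    have : act k (1 : G) = AlgHom.id k (D k G) := D_hom_ext fun g => by simp [act_x]
    exact DFunLike.congr_fun this d
  mul_smul h₁ h₂ d := by
    have : act k (h₁ * h₂).unop = (act k h₁.unop).comp (act k h₂.unop) :=
      D_hom_ext fun g => by simp [act_x, mul_assoc]
    exact DFunLike.congr_fun this d
  smul_zero h := map_zero (act k h.unop)
  smul_add h := map_add (act k h.unop)
  smul_one h := map_one (act k h.unop)
  smul_mul h := map_mul (act k h.unop)

theorem op_smul_x (h g : G) : MulOpposite.op h • x k g = x k (g * h) := act_x k h g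

instance : SMulCommClass Gᵐᵒᵖ k (D k G) where
  smul_comm h c d := map_smul (act k h.unop) c d

/-- The ring of invariants `D_k(G)^G`, as a `k`-subalgebra of `D_k(G)`. -/
abbrev invariants : Subalgebra k (D k G) := FixedPoints.subalgebra k (D k G) Gᵐᵒᵖ

end Fin

end DehomSym

end

section

open Polynomial

/-! The invariants are computed along a chain of subspaces `V` of `V_reg`, stable under left and
right translations, rising one dimension at a time from the line of `∑ X_g` to `V_reg`. Since `G ×
G` is a `p`-group in characteristic `p`, it fixes a nonzero vector of `V_reg / V`; lift it to `w`,
with image `t` in `D_k`. If `N` acts trivially on `V` from the right and `n ∈ N`, then `wn - w` is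
left invariant, because each `hw - w` lies in `V` and is fixed by `n`. So `wn - w` is a multiple of
`∑ X_g`, which is `1` in `D_k`: `N` moves `t` only by constants, forming a finite group `F ⊂ k`
(`exists_isInvariantTower`).

Let `R` be the algebra generated by `V`. Then `R[t]^G = R^G[S(t)]` with `S` monic of degree `|F|`
(`step`). Here `S(t)` is the relative trace of `r ∏ (t + c)`, where `c` runs over `F` and `r ∈ R`
has trace `1`; that makes the leading coefficient `1`. Dividing an invariant by `S` leaves an
invariant remainder of degree below `|F|`, unchanged by the translations in `F` and hence constant
in `t`. A Lagrange polynomial on `F` yields an element of trace `1` for the next stage. Each of the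
`|G| - 1` steps thus adds one polynomial generator. -/

/-- `IsInvariantTower k Γ R N m` records that the `Γ`-stable subalgebra `R` is fixed pointwise by
`N`, that the relative trace from `N` to `Γ` (given by a finite family of group elements) attains
the value `1` on `R`, and that the `Γ`-invariants of `R` form a polynomial ring in `m` variables. -/
structure IsInvariantTower (k : Type*) [Field k] {A : Type*} [CommRing A] [Algebra k A]
    (Γ : Type*) [Group Γ] [MulSemiringAction Γ A] [SMulCommClass Γ k A]
    (R : Subalgebra k A) (N : Subgroup Γ) (m : ℕ) : Prop where
  smul_mem : ∀ g : Γ, ∀ r ∈ R, g • r ∈ R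
  smul_eq : ∀ n ∈ N, ∀ r ∈ R, n • r = r
  trace : ∃ (ι : Type) (_ : Fintype ι) (γ : ι → Γ),
    (∀ y : A, (∀ n ∈ N, n • y = y) → ∀ g : Γ, g • ∑ i, γ i • y = ∑ i, γ i • y) ∧
      ∃ r ∈ R, ∑ i, γ i • r = 1
  polynomial : ∃ (σ : Type) (_ : Fintype σ) (f : σ → A), Fintype.card σ = m ∧
    AlgebraicIndependent k f ∧
      Algebra.adjoin k (Set.range f) = R ⊓ FixedPoints.subalgebra k A Γ

/-! ### Towers and translation groups -/

namespace IsInvariantTower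

variable {k : Type*} [Field k] {A : Type*} [CommRing A] [Algebra k A]
  {Γ : Type*} [Group Γ] [MulSemiringAction Γ A] [SMulCommClass Γ k A]

/-- Start of the induction: on scalars the whole group acts trivially, so the relative trace from
`⊤` is the identity. -/
theorem bot [Nontrivial A] : IsInvariantTower k Γ (⊥ : Subalgebra k A) ⊤ 0 where
  smul_mem g r hr := by
    obtain ⟨c, rfl⟩ := Algebra.mem_bot.1 hr
    rw [smul_algebraMap]
    exact hr
  smul_eq g _ r hr := by
    obtain ⟨c, rfl⟩ := Algebra.mem_bot.1 hr
    rw [smul_algebraMap]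
  trace := ⟨Unit, inferInstance, fun _ => 1,
    fun y hy g => by simpa using hy g trivial, 1, one_mem _, by simp⟩
  polynomial := ⟨Empty, inferInstance, Empty.elim, rfl,
    algebraicIndependent_empty_type_iff.2 (algebraMap k A).injective, by
      rw [Set.range_eq_empty, Algebra.adjoin_empty, bot_inf_eq]⟩

/-- The group of translations `t ↦ t + c`, `c ∈ k`, through which elements of `N` act on `t`. -/
def translations (k : Type*) [Field k] {A : Type*} [CommRing A] [Algebra k A]
    {Γ : Type*} [Group Γ] [MulSemiringAction Γ A] [SMulCommClass Γ k A]
    (N : Subgroup Γ) (t : A) : AddSubgroup k where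
  carrier := {c | ∃ n ∈ N, n • t = t + algebraMap k A c}
  zero_mem' := ⟨1, one_mem _, by simp⟩
  add_mem' := by
    rintro a b ⟨n, hn, h⟩ ⟨n', hn', h'⟩
    refine ⟨n * n', mul_mem hn hn', ?_⟩
    rw [mul_smul, h', smul_add, smul_algebraMap, h, map_add, add_assoc]
  neg_mem' := by
    rintro a ⟨n, hn, h⟩
    refine ⟨n⁻¹, inv_mem hn, ?_⟩
    rw [inv_smul_eq_iff, smul_add, smul_algebraMap, h, map_neg]
    ring

theorem mem_translations {N : Subgroup Γ} {t : A} {c : k} :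
    c ∈ translations k N t ↔ ∃ n ∈ N, n • t = t + algebraMap k A c := Iff.rfl

theorem finite_translations [Nontrivial A] [Finite Γ] (N : Subgroup Γ) (t : A) :
    Finite (translations k N t) := by
  have h : ∀ c : translations k N t, ∃ n : Γ, n • t = t + algebraMap k A c := fun c =>
    let ⟨n, _, hn⟩ := c.2
    ⟨n, hn⟩
  choose n hn using h
  refine Finite.of_injective n fun a b hab => Subtype.ext ?_
  have := hn a
  rw [hab, hn b] at this
  exact ((algebraMap k A).injective (add_left_cancel this)).symm

/-- The subgroup of `N` fixing `t`. -/
def fixing (N : Subgroup Γ) (t : A) : Subgroup Γ := N ⊓ MulAction.stabilizer Γ t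

theorem mem_fixing {N : Subgroup Γ} {t : A} {n : Γ} : n ∈ fixing N t ↔ n ∈ N ∧ n • t = t :=
  Iff.rfl

/-! ### Polynomials in `t` with coefficients in `R` -/

theorem mem_sup_adjoin_singleton {R : Subalgebra k A} {t a : A}
    (ha : a ∈ R ⊔ Algebra.adjoin k {t}) :
    ∃ P ∈ lifts R.val.toRingHom, P.eval t = a := by
  have h : R ⊔ Algebra.adjoin k {t} ≤ ((aeval t : R[X] →ₐ[R] A).restrictScalars k).range := by
    refine sup_le (fun r hr => ⟨C ⟨r, hr⟩, by simp⟩) (Algebra.adjoin_le ?_)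
    rintro _ rfl
    exact ⟨X, by simp⟩
  obtain ⟨P, rfl⟩ := h ha
  exact ⟨P.map R.val.toRingHom, ⟨P, rfl⟩, by simp [eval_map, aeval_def]; rfl⟩

theorem eval_mem_sup_adjoin {R : Subalgebra k A} {t : A} {P : A[X]}
    (hP : P ∈ lifts R.val.toRingHom) : P.eval t ∈ R ⊔ Algebra.adjoin k {t} := by
  obtain ⟨P, rfl⟩ := hP
  have ht : t ∈ R ⊔ Algebra.adjoin k {t} :=
    (le_sup_right : _ ≤ R ⊔ _) (Algebra.self_mem_adjoin_singleton k t)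
  rw [coe_mapRingHom, eval_map, eval₂_eq_sum_range]
  exact sum_mem fun i _ => mul_mem ((le_sup_left : R ≤ _) (P.coeff i).2) (pow_mem ht i)

theorem C_mem_lifts {R : Subalgebra k A} {a : A} (ha : a ∈ R) :
    (C a : A[X]) ∈ lifts R.val.toRingHom := ⟨C ⟨a, ha⟩, by simp⟩

theorem X_mem_lifts' {R : Subalgebra k A} : (X : A[X]) ∈ lifts R.val.toRingHom := X_mem_lifts _

theorem coeff_mem_of_mem_lifts {R : Subalgebra k A} {P : A[X]}
    (hP : P ∈ lifts R.val.toRingHom) (i : ℕ) : P.coeff i ∈ R := by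
  obtain ⟨P, rfl⟩ := hP
  rw [coe_mapRingHom, coeff_map]
  exact (P.coeff i).2

/-- If `q` is a polynomial with `q(0) = 1` vanishing on the other points of a finite additive
subgroup `F`, of degree less than `|F|`, then the translates of `q` by `F` add up to `1`. -/
theorem exists_sum_translates_eq_one (F : AddSubgroup k) [Fintype F] :
    ∃ q : k[X], ∑ f : F, q.comp (X + C (f : k)) = 1 := by
  classical
  let s : Finset k := Finset.univ.map (Function.Embedding.subtype (· ∈ F))
  have hs : ∀ {a}, a ∈ s ↔ a ∈ F := by simp [s]
  have h0 : (0 : k) ∈ s := hs.2 F.zero_mem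
  have hinj : Set.InjOn (id : k → k) s := Function.injective_id.injOn
  have hdeg := Lagrange.degree_basis hinj h0
  have hpos : 0 < s.card := Finset.card_pos.2 ⟨0, h0⟩
  -- Both sides have degree below `|F|`, so it suffices to compare them on `F`; at `a` only the
  -- translate by `-a` contributes.
  refine ⟨Lagrange.basis s id 0, ?_⟩
  apply Polynomial.eq_of_degrees_lt_of_eval_finset_eq s
  · refine (degree_sum_le _ _).trans_lt ((Finset.sup_lt_iff (WithBot.bot_lt_coe _)).2 fun f _ => ?_)
    rw [degree_eq_natDegree (by
      rw [Ne, comp_eq_zero_iff]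
      rintro (h | ⟨_, h⟩)
      · exact Lagrange.basis_ne_zero hinj h0 h
      · have := congrArg natDegree h
        simp at this), natDegree_comp, natDegree_X_add_C, mul_one,
      ← degree_eq_natDegree (Lagrange.basis_ne_zero hinj h0), hdeg]
    exact_mod_cast Nat.sub_lt hpos one_pos
  · rw [degree_one]; exact_mod_cast hpos
  · intro a ha
    rw [eval_finsetSum, Finset.sum_eq_single (-⟨a, hs.1 ha⟩ : F)]
    · have := Lagrange.eval_basis_self hinj h0
      simpa using this
    · intro f _ hf
      have hne : a + (f : k) ≠ 0 := fun h => hf (Subtype.ext (by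
        simpa using (neg_eq_of_add_eq_zero_right h).symm))
      have := Lagrange.eval_basis_of_ne (v := id) (i := (0 : k)) hne.symm
        (hs.2 (F.add_mem (hs.1 ha) f.2))
      simpa using this
    · simp

/-- The substitution on `A[X]` by which `g` acts when `X` is specialised to `t`. -/
noncomputable def polyAct (t : A) (g : Γ) : A[X] →+* A[X] :=
  (compRingHom (X + C (g • t - t))).comp (mapRingHom (MulSemiringAction.toRingHom Γ A g))

theorem polyAct_apply (t : A) (g : Γ) (P : A[X]) :
    polyAct t g P = (P.map (MulSemiringAction.toRingHom Γ A g)).comp (X + C (g • t - t)) := rfl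

theorem eval_polyAct (t : A) (g : Γ) (P : A[X]) : (polyAct t g P).eval t = g • P.eval t := by
  rw [polyAct_apply, eval_comp]
  simp only [eval_add, eval_X, eval_C, add_sub_cancel]
  exact eval_map_apply (f := MulSemiringAction.toRingHom Γ A g) t

theorem natDegree_polyAct [IsDomain A] (t : A) (g : Γ) (P : A[X]) :
    (polyAct t g P).natDegree = P.natDegree := by
  rw [polyAct_apply, natDegree_comp, natDegree_X_add_C, mul_one,
    natDegree_map_eq_of_injective (MulAction.injective g)]

theorem polyAct_mem_lifts {R : Subalgebra k A} (hR : ∀ g : Γ, ∀ r ∈ R, g • r ∈ R) {t : A}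
    (ht : ∀ g : Γ, g • t - t ∈ R) (g : Γ) {P : A[X]} (hP : P ∈ lifts R.val.toRingHom) :
    polyAct t g P ∈ lifts R.val.toRingHom := by
  rw [polyAct_apply, comp_eq_sum_left, sum_def]
  refine sum_mem fun i _ => mul_mem (C_mem_lifts ?_)
    (pow_mem (add_mem X_mem_lifts' (C_mem_lifts (ht g))) i)
  rw [coeff_map]
  exact hR g _ (coeff_mem_of_mem_lifts hP i)

theorem sub_mem_lifts {R : Subalgebra k A} {P Q : A[X]} (hP : P ∈ lifts R.val.toRingHom)
    (hQ : Q ∈ lifts R.val.toRingHom) : P - Q ∈ lifts R.val.toRingHom := by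
  obtain ⟨P, rfl⟩ := hP
  obtain ⟨Q, rfl⟩ := hQ
  exact ⟨P - Q, map_sub _ _ _⟩

theorem divByMonic_mem_lifts {R : Subalgebra k A} {P S : A[X]} (hS : S.Monic)
    (hP : P ∈ lifts R.val.toRingHom) (hS' : S ∈ lifts R.val.toRingHom) :
    P /ₘ S ∈ lifts R.val.toRingHom ∧ P %ₘ S ∈ lifts R.val.toRingHom := by
  obtain ⟨P, rfl⟩ := hP
  obtain ⟨S, rfl⟩ := hS'
  have hS₁ : S.Monic := (Function.Injective.monic_map_iff Subtype.val_injective).2 hS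
  exact ⟨⟨P /ₘ S, map_divByMonic _ hS₁⟩, ⟨P %ₘ S, map_modByMonic _ hS₁⟩⟩

/-! ### The inductive step: adjoining `t` -/

variable {R : Subalgebra k A} {N : Subgroup Γ} {m : ℕ} {t : A}

/-- The relative trace extends from `N` to the subgroup fixing `t`, and still attains `1` after
adjoining `t`. -/
theorem trace_step [Nontrivial A] [Finite Γ] (h : IsInvariantTower k Γ R N m)
    (hN : ∀ n ∈ N, ∃ c : k, n • t = t + algebraMap k A c) :
    ∃ (ι : Type) (_ : Fintype ι) (γ : ι → Γ),
      (∀ y : A, (∀ n ∈ fixing N t, n • y = y) → ∀ g : Γ, g • ∑ i, γ i • y = ∑ i, γ i • y) ∧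
        ∃ r ∈ R ⊔ Algebra.adjoin k {t}, ∑ i, γ i • r = 1 := by
  obtain ⟨ι, _, γ, hγ, r, hr, hr1⟩ := h.trace
  have := finite_translations (k := k) N t
  have := Fintype.ofFinite (translations k N t)
  -- Reindexing by `Fin` keeps the index type of the trace in `Type`.
  let e := (Fintype.equivFin (translations k N t)).symm
  choose ν hνN hν using fun c : translations k N t => mem_translations.1 c.2
  have hsum : ∀ y : A, ∑ j : ι × Fin (Fintype.card (translations k N t)),
      (γ j.1 * ν (e j.2)) • y = ∑ i, γ i • ∑ c, ν c • y := fun y => by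
    rw [Fintype.sum_prod_type]
    refine Finset.sum_congr rfl fun i _ => ?_
    rw [Finset.smul_sum, ← e.sum_comp]
    exact Finset.sum_congr rfl fun j _ => mul_smul _ _ _
  -- The `ν c` represent the cosets of `fixing N t` in `N`, one per translation, so this is
  -- transitivity of the trace.
  refine ⟨ι × Fin (Fintype.card (translations k N t)), inferInstance,
    fun j => γ j.1 * ν (e j.2), fun y hy g => ?_, ?_⟩
  · rw [hsum]
    refine hγ _ (fun n hn => ?_) g
    obtain ⟨c, hc⟩ := hN n hn
    let c' : translations k N t := ⟨c, n, hn, hc⟩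
    rw [Finset.smul_sum, ← Equiv.sum_comp (Equiv.addLeft c') (fun c => ν c • y)]
    refine Finset.sum_congr rfl fun f _ => ?_
    -- Both `n * ν f` and `ν (c' + f)` translate `t` by `c + f`: left multiplication by `n` permutes
    -- the cosets.
    have hmem : (ν (c' + f))⁻¹ * (n * ν f) ∈ fixing N t := by
      refine mem_fixing.2 ⟨mul_mem (inv_mem (hνN _)) (mul_mem hn (hνN _)), ?_⟩
      rw [mul_smul, inv_smul_eq_iff, mul_smul, hν, hν, smul_add, smul_algebraMap, hc,
        AddSubgroup.coe_add, map_add, add_assoc]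
    have := hy _ hmem
    rw [mul_smul, inv_smul_eq_iff, mul_smul] at this
    exact this
  · obtain ⟨q, hq⟩ := exists_sum_translates_eq_one (translations k N t)
    -- `N` fixes `r`, so the inner sum over `F` returns `r`, whose outer trace is `1`.
    refine ⟨r * aeval t q, mul_mem ((le_sup_left : R ≤ _) hr)
      ((le_sup_right : _ ≤ R ⊔ _) (aeval_mem_adjoin_singleton k t)), ?_⟩
    have hν1 : ∑ c, ν c • (r * aeval t q) = r := by
      have : ∀ c, ν c • (r * aeval t q) = r * aeval t (q.comp (X + C (c : k))) := fun c => by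
        rw [smul_mul', h.smul_eq _ (hνN c) r hr, aeval_comp, map_add, aeval_X, aeval_C, ← hν]
        congr 1
        exact (aeval_algHom_apply (MulSemiringAction.toAlgHom k A (ν c)) t q).symm
      simp_rw [this]
      rw [← Finset.mul_sum, ← map_sum, hq, map_one, mul_one]
    rw [hsum, hν1, hr1]

/-- There is a `Γ`-invariant which is a monic polynomial in `t` over `R`, of degree the number of
translations of `t` by `N`. -/
theorem exists_monic [IsDomain A] [Finite Γ] (h : IsInvariantTower k Γ R N m)
    (ht : ∀ g : Γ, g • t - t ∈ R) (hN : ∀ n ∈ N, ∃ c : k, n • t = t + algebraMap k A c) :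
    ∃ S ∈ lifts R.val.toRingHom, S.Monic ∧ S.natDegree = Nat.card (translations k N t) ∧
      ∀ g : Γ, g • S.eval t = S.eval t := by
  obtain ⟨ι, _, γ, hγ, r, hr, hr1⟩ := h.trace
  have := finite_translations (k := k) N t
  have := Fintype.ofFinite (translations k N t)
  let Q : Γ → A[X] := fun g =>
    ∏ c : translations k N t, (X + C (g • t - t + algebraMap k A c))
  have hQmonic : ∀ g, (Q g).Monic := fun g => monic_prod_of_monic _ _ fun c _ => monic_X_add_C _
  have hQdeg : ∀ g, (Q g).natDegree = Fintype.card (translations k N t) := fun g => by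
    rw [natDegree_prod_of_monic _ _ fun c _ => monic_X_add_C _]
    simp only [natDegree_X_add_C, Finset.sum_const, Finset.card_univ, smul_eq_mul, mul_one]
  have hQeval : ∀ g, (Q g).eval t = g • ∏ c : translations k N t, (t + algebraMap k A c) :=
    fun g => by
    rw [eval_prod, Finset.smul_prod']
    refine Finset.prod_congr rfl fun c _ => ?_
    rw [smul_add, smul_algebraMap, eval_add, eval_X, eval_C]
    ring
  have hQR : ∀ g, Q g ∈ lifts R.val.toRingHom := fun g => prod_mem fun c _ =>
    add_mem X_mem_lifts' (C_mem_lifts (add_mem (ht g) (R.algebraMap_mem c)))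
  -- The trace of `r ∏ (t + c)` written as a polynomial in `t`; its top coefficient is the trace of
  -- `r`.
  let S : A[X] := ∑ i, C (γ i • r) * Q (γ i)
  have hSdeg : S.natDegree ≤ Fintype.card (translations k N t) :=
    natDegree_sum_le_of_forall_le _ _ fun i _ =>
      (natDegree_C_mul_le _ _).trans (hQdeg _).le
  have hSc : S.coeff (Fintype.card (translations k N t)) = 1 := by
    rw [finsetSum_coeff, ← hr1]
    refine Finset.sum_congr rfl fun i _ => ?_
    rw [coeff_C_mul, ← hQdeg (γ i), (hQmonic _).coeff_natDegree, mul_one]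
  refine ⟨S, sum_mem fun i _ => mul_mem (C_mem_lifts (h.smul_mem _ r hr)) (hQR _),
    monic_of_natDegree_le_of_coeff_eq_one _ hSdeg hSc, ?_, fun g => ?_⟩
  · rw [Nat.card_eq_fintype_card]
    exact le_antisymm hSdeg (le_natDegree_of_ne_zero (by rw [hSc]; exact one_ne_zero))
  · have hS : S.eval t = ∑ i, γ i • (r * ∏ c : translations k N t, (t + algebraMap k A c)) := by
      rw [eval_finsetSum]
      refine Finset.sum_congr rfl fun i _ => ?_
      rw [eval_mul, eval_C, hQeval, smul_mul']
    rw [hS]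
    refine hγ _ (fun n hn => ?_) g
    obtain ⟨c, hc⟩ := hN n hn
    let c' : translations k N t := ⟨c, n, hn, hc⟩
    rw [smul_mul', h.smul_eq n hn r hr, Finset.smul_prod']
    congr 1
    rw [← Equiv.prod_comp (Equiv.addLeft c')
      (fun c : translations k N t => t + algebraMap k A (c : k))]
    refine Finset.prod_congr rfl fun f _ => ?_
    simp only [Equiv.coe_addLeft, AddSubgroup.coe_add, map_add]
    rw [smul_add, smul_algebraMap, hc, add_assoc]

/-- `t` satisfies no nontrivial polynomial relation over `R`. -/
def IsTranscendentalOver (R : Subalgebra k A) (t : A) : Prop :=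
  ∀ P ∈ lifts R.val.toRingHom, P.eval t = 0 → P = 0

/-- Invariants in `R[t]` are polynomials in an invariant monic polynomial `S(t)`. -/
theorem eval_mem_adjoin [IsDomain A] [Finite Γ] (h : IsInvariantTower k Γ R N m)
    (htr : IsTranscendentalOver R t) (ht : ∀ g : Γ, g • t - t ∈ R) {S : A[X]}
    (hSR : S ∈ lifts R.val.toRingHom) (hS : S.Monic)
    (hSdeg : S.natDegree = Nat.card (translations k N t))
    (hSinv : ∀ g : Γ, g • S.eval t = S.eval t) (n : ℕ) :
    ∀ P ∈ lifts R.val.toRingHom, P.natDegree ≤ n → (∀ g : Γ, g • P.eval t = P.eval t) →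
      P.eval t ∈ (R ⊓ FixedPoints.subalgebra k A Γ) ⊔ Algebra.adjoin k {S.eval t} := by
  have := finite_translations (k := k) N t
  have := Fintype.ofFinite (translations k N t)
  have hcard : 0 < Nat.card (translations k N t) := Nat.card_pos
  -- By transcendence of `t`, invariance of the value `P(t)` forces invariance of `P` itself.
  have hinv : ∀ P ∈ lifts R.val.toRingHom, (∀ g : Γ, g • P.eval t = P.eval t) →
      ∀ g : Γ, polyAct t g P = P := fun P hP hPi g => by
    refine sub_eq_zero.1 (htr _ (sub_mem_lifts (polyAct_mem_lifts h.smul_mem ht g hP) hP) ?_)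
    rw [eval_sub, eval_polyAct, hPi, sub_self]
  have hS1 : S ≠ 1 := by
    rintro rfl
    rw [natDegree_one] at hSdeg
    omega
  have hconst : ∀ P ∈ lifts R.val.toRingHom, P.natDegree < Nat.card (translations k N t) →
      (∀ g : Γ, g • P.eval t = P.eval t) →
      P.eval t ∈ (R ⊓ FixedPoints.subalgebra k A Γ) ⊔ Algebra.adjoin k {S.eval t} := by
    intro P hP hPd hPi
    -- `N` fixes the coefficients, so `P(X + c) = P(X)` for `c ∈ F`; thus `P - P(0)` has `|F|` roots
    -- but smaller degree.
    have hPc : P = C (P.coeff 0) := by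
      rw [← sub_eq_zero]
      refine eq_zero_of_natDegree_lt_card_of_eval_eq_zero _
        (f := fun c : translations k N t => algebraMap k A c)
        (fun a b hab => Subtype.ext ((algebraMap k A).injective hab)) (fun c => ?_) ?_
      · obtain ⟨n, hn, hnc⟩ := mem_translations.1 c.2
        have hmap : P.map (MulSemiringAction.toRingHom Γ A n) = P := by
          ext i
          rw [coeff_map]
          exact h.smul_eq n hn _ (coeff_mem_of_mem_lifts hP i)
        have := congrArg (eval 0) (hinv P hP hPi n)
        rw [polyAct_apply, hmap, hnc, add_sub_cancel_left, eval_comp] at this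
        simp only [eval_add, eval_X, eval_C, zero_add] at this
        rw [eval_sub, this, eval_C, coeff_zero_eq_eval_zero, sub_self]
      · rw [natDegree_sub_C, ← Nat.card_eq_fintype_card]
        exact hPd
    refine (le_sup_left : R ⊓ _ ≤ _) ⟨?_, hPi⟩
    rw [hPc, eval_C]
    exact coeff_mem_of_mem_lifts hP 0
  induction n with
  | zero => exact fun P hP hPd => hconst P hP (by omega)
  | succ n ih =>
    intro P hP hPd hPi
    obtain ⟨hQR, hMR⟩ := divByMonic_mem_lifts hS hP hSR
    have hdecomp := modByMonic_add_div P S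
    -- Uniqueness of division by the invariant `S` makes quotient and remainder invariant.
    have hdiv : ∀ g : Γ, P /ₘ S = polyAct t g (P /ₘ S) ∧ P %ₘ S = polyAct t g (P %ₘ S) := by
      intro g
      refine div_modByMonic_unique _ _ hS ⟨?_, ?_⟩
      · have := congrArg (polyAct t g) hdecomp
        rwa [map_add, map_mul, hinv S hSR hSinv, hinv P hP hPi] at this
      · by_cases h0 : P %ₘ S = 0
        · rw [h0, map_zero, degree_zero]
          exact bot_lt_iff_ne_bot.2 (degree_ne_bot.2 hS.ne_zero)
        · refine degree_lt_degree ?_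
          rw [natDegree_polyAct]
          exact natDegree_modByMonic_lt P hS hS1
    rw [← hdecomp, eval_add, eval_mul]
    refine add_mem (hconst _ hMR (hSdeg ▸ natDegree_modByMonic_lt P hS hS1) fun g => ?_)
      (mul_mem ((le_sup_right : _ ≤ (R ⊓ FixedPoints.subalgebra k A Γ) ⊔ _)
        (Algebra.self_mem_adjoin_singleton k _))
        (ih _ hQR ?_ fun g => ?_))
    · rw [← eval_polyAct, ← (hdiv g).2]
    · rw [natDegree_divByMonic P hS]; omega
    · rw [← eval_polyAct, ← (hdiv g).1]

/-- The new polynomial generator is `S(t)`, and the new subgroup is the part of `N` that fixes `t`.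
-/
theorem step [IsDomain A] [Finite Γ] (h : IsInvariantTower k Γ R N m)
    (htr : IsTranscendentalOver R t) (ht : ∀ g : Γ, g • t - t ∈ R)
    (hN : ∀ n ∈ N, ∃ c : k, n • t = t + algebraMap k A c) :
    IsInvariantTower k Γ (R ⊔ Algebra.adjoin k {t}) (fixing N t) (m + 1) where
  smul_mem g r hr := by
    obtain ⟨P, hP, rfl⟩ := mem_sup_adjoin_singleton hr
    rw [← eval_polyAct]
    exact eval_mem_sup_adjoin (polyAct_mem_lifts h.smul_mem ht g hP)
  smul_eq n hn r hr := by
    obtain ⟨hnN, hnt⟩ := mem_fixing.1 hn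
    have : R ⊔ Algebra.adjoin k {t} ≤
        AlgHom.equalizer (MulSemiringAction.toAlgHom k A n) (AlgHom.id k A) :=
      sup_le (h.smul_eq n hnN) (Algebra.adjoin_le (by rintro _ rfl; exact hnt))
    exact this hr
  trace := h.trace_step hN
  polynomial := by
    obtain ⟨σ, _, f, hσ, hf, hadj⟩ := h.polynomial
    obtain ⟨S, hSR, hS, hSdeg, hSinv⟩ := h.exists_monic ht hN
    have := finite_translations (k := k) N t
    have hcard : 0 < Nat.card (translations k N t) := Nat.card_pos
    refine ⟨Option σ, inferInstance, fun o => o.elim (S.eval t) f, by simp [hσ], ?_, ?_⟩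
    · refine AlgebraicIndependent.option_iff.2 ⟨hf, ?_⟩
      rw [transcendental_iff]
      intro Q hQ
      have hle : Algebra.adjoin k (Set.range f) ≤ R := hadj ▸ inf_le_left
      have hinj : Function.Injective (algebraMap (Algebra.adjoin k (Set.range f)) A) :=
        Subtype.val_injective
      refine (Polynomial.map_eq_zero_iff hinj).1 ?_
      -- A relation `Q(S(t)) = 0` gives `Q ∘ S = 0`, and `S` is nonconstant because `|F| ≥ 1`.
      have hcomp : (Q.map (algebraMap (Algebra.adjoin k (Set.range f)) A)).comp S = 0 := by
        refine htr _ ?_ ?_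
        · rw [comp_eq_sum_left, sum_def]
          refine sum_mem fun i _ => mul_mem (C_mem_lifts ?_) (pow_mem hSR i)
          rw [coeff_map]
          exact hle (Q.coeff i).2
        · rw [eval_comp, eval_map_algebraMap, hQ]
      rcases comp_eq_zero_iff.1 hcomp with h0 | ⟨_, h0⟩
      · exact h0
      · rw [h0, natDegree_C] at hSdeg
        omega
    · have hrange : Set.range (fun o : Option σ => o.elim (S.eval t) f) =
          Set.range f ∪ {S.eval t} := by
        ext a
        simp [Option.exists, eq_comm]
      rw [hrange, Algebra.adjoin_union, hadj]
      refine le_antisymm (sup_le (inf_le_inf_right _ le_sup_left) (Algebra.adjoin_le ?_)) ?_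
      · rintro _ rfl
        exact ⟨eval_mem_sup_adjoin hSR, hSinv⟩
      · rintro a ⟨ha, hai⟩
        obtain ⟨P, hP, rfl⟩ := mem_sup_adjoin_singleton ha
        exact h.eval_mem_adjoin htr ht hSR hS hSdeg hSinv _ P hP le_rfl hai

end IsInvariantTower

/-! ### Fixed vectors of `p`-groups in characteristic `p` -/

/-- A finite `p`-group acting linearly on a nonzero vector space in characteristic `p` fixes a
nonzero vector. -/
theorem IsPGroup.exists_ne_zero_forall_apply_eq {p : ℕ} [Fact p.Prime] {k : Type*} [Field k]
    [CharP k p] {P : Type*} [Group P] [Finite P] (hP : IsPGroup p P) {M : Type*} [AddCommGroup M]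
    [Module k M] [Nontrivial M] (ρ : Representation k P M) : ∃ m : M, m ≠ 0 ∧ ∀ g, ρ g m = m := by
  obtain ⟨v, hv⟩ := exists_ne (0 : M)
  -- The additive span of one orbit is finitely generated and killed by `p`, hence finite; this
  -- permits counting fixed points over any `k`.
  let L : AddSubgroup M := AddSubgroup.closure (Set.range fun g => ρ g v)
  have hstable : ∀ g : P, ∀ x ∈ L, ρ g x ∈ L := fun g x hx => by
    have : L ≤ L.comap (ρ g).toAddMonoidHom := by
      refine (AddSubgroup.closure_le _).2 ?_
      rintro _ ⟨h, rfl⟩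
      exact AddSubgroup.subset_closure ⟨g * h, by simp⟩
    exact this hx
  have hp : ∀ x : M, p • x = 0 := fun x => by
    rw [← Nat.cast_smul_eq_nsmul k, CharP.cast_eq_zero, zero_smul]
  let _ : MulAction P L :=
    { smul := fun g x => ⟨ρ g x, hstable g x x.2⟩
      one_smul := fun x => Subtype.ext (by change ρ 1 (x : M) = x; simp)
      mul_smul := fun g h x => Subtype.ext (by
        change ρ (g * h) (x : M) = ρ g (ρ h x)
        simp) }
  have hpL : ∀ x : L, p • x = 0 := fun x => Subtype.ext (hp x)
  have : AddGroup.FG L := by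
    rw [AddGroup.fg_iff_addSubgroup_fg]
    exact ⟨(Set.finite_range fun g => ρ g v).toFinset, by simp [L]⟩
  have : Finite L := AddCommGroup.finite_of_fg_isAddTorsion L fun x =>
    isOfFinAddOrder_iff_nsmul_eq_zero.2 ⟨p, (Fact.out : p.Prime).pos, hpL x⟩
  have hvL : v ∈ L := AddSubgroup.subset_closure ⟨1, by simp⟩
  have hdvd : p ∣ Nat.card L := by
    have h1 : addOrderOf (⟨v, hvL⟩ : L) = p :=
      addOrderOf_eq_prime (hpL _) fun h => hv (congrArg Subtype.val h)
    rw [← h1]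
    exact addOrderOf_dvd_natCard _
  -- The number of fixed points is divisible by `p`, and `0` is one of them.
  obtain ⟨b, hb, hb0⟩ := hP.exists_fixed_point_of_prime_dvd_card_of_fixed_point L hdvd
    (a := (0 : L)) fun g => Subtype.ext (map_zero (ρ g))
  exact ⟨b, fun h => hb0 (Subtype.ext h.symm), fun g => congrArg Subtype.val (hb g)⟩

/-- A proper invariant subspace of a representation of a `p`-group in characteristic `p` can be
enlarged by a vector which is fixed modulo the subspace. -/
theorem IsPGroup.exists_notMem_forall_sub_mem {p : ℕ} [Fact p.Prime] {k : Type*} [Field k]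
    [CharP k p] {P : Type*} [Group P] [Finite P] (hP : IsPGroup p P) {M : Type*} [AddCommGroup M]
    [Module k M] (ρ : Representation k P M) {V : Submodule k M} (hV : V ≠ ⊤)
    (hst : ∀ g, V ≤ V.comap (ρ g)) : ∃ w, w ∉ V ∧ ∀ g, ρ g w - w ∈ V := by
  have : Nontrivial (M ⧸ V) := Submodule.Quotient.nontrivial_iff.2 hV
  obtain ⟨m, hm, hfix⟩ := hP.exists_ne_zero_forall_apply_eq (ρ.quotient V hst)
  obtain ⟨w, rfl⟩ := Submodule.Quotient.mk_surjective V m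
  exact ⟨w, fun h => hm ((Submodule.Quotient.mk_eq_zero V).2 h), fun g =>
    (Submodule.Quotient.eq V).1 (hfix g)⟩

/-! ### The biregular representation and the structure of `D_k(G)` -/

namespace DehomSym

variable (k : Type*) [Field k] (G : Type*) [Group G]

/-- The representation of `G × G` on `V_reg` by left and right translations,
`X_g ↦ X_{a g b⁻¹}`. -/
noncomputable def biregular : Representation k (G × G) (Vreg k G) where
  toFun a := Finsupp.lmapDomain k k fun g => a.1 * g * a.2⁻¹
  map_one' := by ext; simp
  map_mul' a b := by
    refine Finsupp.lhom_ext' fun g => LinearMap.ext_ring ?_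
    simp [Finsupp.mapDomain_single, mul_assoc]

variable {k G} in
theorem biregular_single (a : G × G) (g : G) (c : k) :
    biregular k G a (Finsupp.single g c) = Finsupp.single (a.1 * g * a.2⁻¹) c := by
  simp [biregular, Finsupp.mapDomain_single]

variable {k G} in
theorem regularAct_eq_biregular (h : G) : regularAct k h = biregular k G (1, h⁻¹) := by
  refine Finsupp.lhom_ext' fun g => LinearMap.ext_ring ?_
  simp [regularAct, biregular]

variable [Finite G]

/-- The vector `∑_g X_g` of `V_reg`. -/
noncomputable def total : Vreg k G := Finsupp.equivFunOnFinite.symm fun _ => 1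

/-- The linear map `V_reg → D_k(G)` with `X_g ↦ x_g`. -/
noncomputable def toD : Vreg k G →ₗ[k] D k G :=
  (mk k G).toLinearMap ∘ₗ SymmetricAlgebra.ι k (Vreg k G)

variable {k G}

theorem total_apply (g : G) : total k G g = 1 := rfl

theorem total_eq_sum [Fintype G] : total k G = ∑ g, Finsupp.single g 1 :=
  (Finsupp.univ_sum_single (total k G)).symm

theorem biregular_total (a : G × G) : biregular k G a (total k G) = total k G := by
  have := Fintype.ofFinite G
  rw [total_eq_sum, map_sum]
  simp_rw [biregular_single]
  exact Fintype.sum_equiv ((Equiv.mulLeft a.1).trans (Equiv.mulRight a.2⁻¹)) _ _ fun _ => rfl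

/-- The vectors of `V_reg` invariant under left translations are the multiples of `∑_g X_g`. -/
theorem eq_smul_total {v : Vreg k G} (hv : ∀ h : G, biregular k G (h, 1) v = v) :
    v = v 1 • total k G := by
  have key : ∀ (h : G) (v : Vreg k G), biregular k G (h, 1) v h = v 1 := by
    intro h v
    have : (Finsupp.lapply h : Vreg k G →ₗ[k] k) ∘ₗ biregular k G (h, 1) = Finsupp.lapply 1 := by
      classical
      refine Finsupp.lhom_ext' fun g => LinearMap.ext_ring ?_
      simp [biregular_single, Finsupp.single_apply]
    exact LinearMap.congr_fun this v
  ext h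
  rw [Finsupp.smul_apply, total_apply, smul_eq_mul, mul_one, ← key h v, hv]

theorem toD_single (g : G) : toD k G (Finsupp.single g 1) = x k g := rfl

theorem toD_total : toD k G (total k G) = 1 := by
  have := Fintype.ofFinite G
  have h := mk_alpha k G
  rw [alpha, finsum_eq_sum_of_fintype, map_add, map_neg, map_one, map_sum, neg_add_eq_zero] at h
  rw [total_eq_sum, map_sum, h]
  rfl

theorem op_smul_toD (h : G) (v : Vreg k G) :
    MulOpposite.op h • toD k G v = toD k G (biregular k G (1, h⁻¹) v) := by
  rw [← regularAct_eq_biregular]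
  refine (act_mk k h _).trans ?_
  rw [symAct, SymmetricAlgebra.lift_ι_apply]
  rfl

/-- An algebra homomorphism out of `D_k(G)` is given by a linear map on `V_reg` sending `∑_g X_g`
to `1`. -/
theorem exists_algHom {B : Type*} [CommRing B] [Algebra k B] (f : Vreg k G →ₗ[k] B)
    (hf : f (total k G) = 1) : ∃ φ : D k G →ₐ[k] B, ∀ v, φ (toD k G v) = f v := by
  have hα : SymmetricAlgebra.lift f (alpha k G) = 0 := by
    have := Fintype.ofFinite G
    rw [alpha, finsum_eq_sum_of_fintype, map_add, map_neg, map_one, map_sum, neg_add_eq_zero,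
      ← hf, total_eq_sum, map_sum]
    exact Finset.sum_congr rfl fun g _ => (SymmetricAlgebra.lift_ι_apply f _).symm
  have hle : Ideal.span {alpha k G} ≤ RingHom.ker (SymmetricAlgebra.lift f) := by
    rwa [Ideal.span_singleton_le_iff_mem, RingHom.mem_ker]
  exact ⟨Ideal.Quotient.liftₐ (Ideal.span {alpha k G}) (SymmetricAlgebra.lift f)
    fun a ha => hle ha, fun v => SymmetricAlgebra.lift_ι_apply f v⟩

/-- Eliminating `x_1 = 1 - ∑_{h ≠ 1} x_h` embeds `D_k(G)` in a polynomial ring; evaluation at the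
`x_g` is a left inverse. -/
instance : IsDomain (D k G) := by
  classical
  have := Fintype.ofFinite G
  let f : Vreg k G →ₗ[k] MvPolynomial G k := Finsupp.linearCombination k fun g =>
    if g = 1 then 1 - ∑ h ∈ Finset.univ.erase (1 : G), MvPolynomial.X h else MvPolynomial.X g
  have hfs : ∀ g, f (Finsupp.single g 1) =
      if g = 1 then 1 - ∑ h ∈ Finset.univ.erase (1 : G), MvPolynomial.X h
        else MvPolynomial.X g := fun g => by simp [f]
  obtain ⟨φ, hφ⟩ := exists_algHom f (by
    rw [total_eq_sum, map_sum, ← Finset.add_sum_erase _ _ (Finset.mem_univ (1 : G)), hfs,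
      if_pos rfl, Finset.sum_congr rfl fun g hg => (hfs g).trans (if_neg (Finset.ne_of_mem_erase hg))]
    ring)
  have hψ : ((MvPolynomial.aeval fun g => x k g).comp φ : D k G →ₐ[k] D k G) = AlgHom.id k _ := by
    refine D_hom_ext fun g => ?_
    rw [AlgHom.comp_apply, ← toD_single, hφ, hfs]
    split_ifs with hg
    · have h1 := toD_total (k := k) (G := G)
      rw [total_eq_sum, map_sum, ← Finset.add_sum_erase _ _ (Finset.mem_univ (1 : G))] at h1
      simp only [map_sub, map_one, map_sum, MvPolynomial.aeval_X, hg, AlgHom.id_apply]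
      rw [sub_eq_iff_eq_add, ← h1]
      rfl
    · rw [MvPolynomial.aeval_X]
      rfl
  have hinj : Function.Injective φ :=
    Function.LeftInverse.injective (g := MvPolynomial.aeval fun g => x k g)
      (DFunLike.congr_fun hψ)
  exact Function.Injective.isDomain φ.toRingHom hinj

/-! ### Subalgebras generated by subspaces -/

/-- The subalgebra of `D_k(G)` generated by a subspace of `V_reg`. -/
noncomputable def generated (V : Submodule k (Vreg k G)) : Subalgebra k (D k G) :=
  Algebra.adjoin k (toD k G '' V)

theorem toD_mem_generated {V : Submodule k (Vreg k G)} {v : Vreg k G} (hv : v ∈ V) :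
    toD k G v ∈ generated V := Algebra.subset_adjoin ⟨v, hv, rfl⟩

theorem generated_total : generated (k ∙ total k G) = ⊥ := by
  refine le_bot_iff.1 (Algebra.adjoin_le ?_)
  rintro _ ⟨v, hv, rfl⟩
  obtain ⟨c, rfl⟩ := Submodule.mem_span_singleton.1 hv
  rw [map_smul, toD_total]
  exact Subalgebra.smul_mem _ (one_mem _) c

theorem generated_top : generated (⊤ : Submodule k (Vreg k G)) = ⊤ := by
  have h : (AlgHom.id k (D k G)).range ≤ generated ⊤ := by
    rintro _ ⟨d, rfl⟩
    obtain ⟨s, rfl⟩ := mk_surjective k G d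
    induction s using SymmetricAlgebra.induction with
    | algebraMap r => rw [AlgHom.commutes]; exact Subalgebra.algebraMap_mem _ r
    | ι v => exact toD_mem_generated (V := ⊤) trivial
    | mul a b ha hb => rw [map_mul]; exact mul_mem ha hb
    | add a b ha hb => rw [map_add]; exact add_mem ha hb
  exact top_le_iff.1 fun d _ => h ⟨d, rfl⟩

theorem generated_sup_singleton (V : Submodule k (Vreg k G)) (w : Vreg k G) :
    generated (V ⊔ k ∙ w) = generated V ⊔ Algebra.adjoin k {toD k G w} := by
  refine le_antisymm (Algebra.adjoin_le ?_) (sup_le (Algebra.adjoin_mono ?_)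
    (Algebra.adjoin_le (Set.singleton_subset_iff.2 ?_)))
  · rintro _ ⟨u, hu, rfl⟩
    obtain ⟨v, hv, z, hz, rfl⟩ := Submodule.mem_sup.1 hu
    obtain ⟨c, hc⟩ := Submodule.mem_span_singleton.1 hz
    have hv' := (le_sup_left : generated V ≤ generated V ⊔ Algebra.adjoin k {toD k G w})
      (toD_mem_generated hv)
    have hw' := (le_sup_right : _ ≤ generated V ⊔ Algebra.adjoin k {toD k G w})
      (Algebra.self_mem_adjoin_singleton k (toD k G w))
    rw [← hc, map_add, map_smul]
    exact add_mem hv' (Subalgebra.smul_mem _ hw' c)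
  · exact Set.image_mono (le_sup_left : V ≤ _)
  · exact toD_mem_generated (Submodule.mem_sup_right (Submodule.mem_span_singleton_self w))

/-- A vector outside a subspace containing `∑_g X_g` is transcendental over the subalgebra
generated by the subspace. -/
theorem isTranscendentalOver_generated {V : Submodule k (Vreg k G)} (hV : total k G ∈ V)
    {w : Vreg k G} (hw : w ∉ V) :
    IsInvariantTower.IsTranscendentalOver (generated V) (toD k G w) := by
  -- With `l` zero on `V` and `l w ≠ 0`, the shear `v ↦ v + l(v) X` fixes `generated V` and turns
  -- `P(t) = 0` into `P(t + l(w) X) = 0`, a nonconstant substitution.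
  obtain ⟨l, hlw, hlV⟩ := Submodule.exists_le_ker_of_notMem hw
  obtain ⟨φ, hφ⟩ := exists_algHom (B := (D k G)[X])
    (((CAlgHom : D k G →ₐ[k] (D k G)[X]).toLinearMap ∘ₗ toD k G) +
      (LinearMap.toSpanSingleton k (D k G)[X] Polynomial.X) ∘ₗ l) (by
      have : l (total k G) = 0 := hlV hV
      simp [this, toD_total])
  have hφV : generated V ≤ AlgHom.equalizer φ CAlgHom := by
    refine Algebra.adjoin_le ?_
    rintro _ ⟨v, hv, rfl⟩
    have : l v = 0 := hlV hv
    change φ _ = CAlgHom _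
    simp [hφ, this]
  intro P hP hPt
  have hmap : P.map φ.toRingHom = P.map C := by
    ext1 i
    rw [coeff_map, coeff_map]
    exact hφV (IsInvariantTower.coeff_mem_of_mem_lifts hP i)
  have h0 : φ (P.eval (toD k G w)) = 0 := by rw [hPt, map_zero]
  have h1 : (P.map C).eval (φ (toD k G w)) = 0 := by
    rw [← h0, ← hmap]
    exact eval_map_apply (f := φ.toRingHom) _
  have h2 : P.comp (C (toD k G w) + C (algebraMap k (D k G) (l w)) * Polynomial.X) = 0 := by
    rw [comp, ← eval_map, ← h1, hφ]
    simp [Algebra.smul_def]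
  rcases comp_eq_zero_iff.1 h2 with h | ⟨_, h⟩
  · exact h
  · have := congrArg (fun Q => coeff Q 1) h
    simp at this
    exact absurd this hlw

/-! ### Construction of the chain of biinvariant subspaces -/

/-- Every intermediate dimension occurs among the biinvariant subspaces `V` of `V_reg` for which
the invariants of the subalgebra generated by `V` form a polynomial ring. -/
theorem exists_isInvariantTower (p : ℕ) [Fact p.Prime] [CharP k p] (hG : IsPGroup p G) (m : ℕ)
    (hm : m + 1 ≤ Nat.card G) :
    ∃ (V : Submodule k (Vreg k G)) (N : Subgroup Gᵐᵒᵖ), (∀ a, V ≤ V.comap (biregular k G a)) ∧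
      total k G ∈ V ∧ Module.finrank k V = m + 1 ∧
      (∀ n ∈ N, ∀ v ∈ V, biregular k G (1, n.unop⁻¹) v = v) ∧
      IsInvariantTower k Gᵐᵒᵖ (generated V) N m := by
  have hGG : IsPGroup p (G × G) := by
    obtain ⟨n, hn⟩ := IsPGroup.iff_card.1 hG
    exact IsPGroup.of_card (n := n + n) (by rw [Nat.card_prod, hn, pow_add])
  induction m with
  | zero =>
    refine ⟨k ∙ total k G, ⊤, fun a => ?_, Submodule.mem_span_singleton_self _,
      finrank_span_singleton fun h => ?_, fun n _ v hv => ?_, ?_⟩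
    · rw [Submodule.span_singleton_le_iff_mem, Submodule.mem_comap, biregular_total]
      exact Submodule.mem_span_singleton_self _
    · exact one_ne_zero (DFunLike.congr_fun h (1 : G))
    · obtain ⟨c, rfl⟩ := Submodule.mem_span_singleton.1 hv
      rw [map_smul, biregular_total]
    · rw [generated_total]
      exact IsInvariantTower.bot
  | succ m ih =>
    obtain ⟨V, N, hst, htot, hdim, hN, hT⟩ := ih (by omega)
    have hV : V ≠ ⊤ := by
      rintro rfl
      have := Fintype.ofFinite G
      rw [finrank_top, Module.finrank_finsupp_self, ← Nat.card_eq_fintype_card] at hdim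
      omega
    obtain ⟨w, hw, hfix⟩ := hGG.exists_notMem_forall_sub_mem (biregular k G) hV hst
    have hsmul : ∀ (n : Gᵐᵒᵖ) (v : Vreg k G),
        n • toD k G v = toD k G (biregular k G (1, n.unop⁻¹) v) := fun n v => by
      rw [← op_smul_toD, MulOpposite.op_unop]
    -- Left and right translations commute and `n` fixes `hw - w ∈ V`, so `wn - w` is left
    -- invariant.
    have hconst : ∀ n ∈ N, ∃ c : k, biregular k G (1, n.unop⁻¹) w = w + c • total k G := by
      intro n hn
      refine ⟨_, sub_eq_iff_eq_add'.1 (eq_smul_total fun h => ?_)⟩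
      have h1 := hN n hn _ (hfix (h, 1))
      have hcomm : biregular k G (h, 1) (biregular k G (1, n.unop⁻¹) w) =
          biregular k G (1, n.unop⁻¹) (biregular k G (h, 1) w) := by
        rw [← Module.End.mul_apply, ← Module.End.mul_apply, ← map_mul, ← map_mul]
        simp
      rw [map_sub, sub_eq_sub_iff_sub_eq_sub] at h1
      rw [map_sub, hcomm, h1]
    have : Finite Gᵐᵒᵖ := Finite.of_equiv G MulOpposite.opEquiv
    have hstep := hT.step (t := toD k G w) (isTranscendentalOver_generated htot hw)
      (fun g => by
        rw [hsmul, ← map_sub]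
        exact toD_mem_generated (hfix _))
      (fun n hn => by
        obtain ⟨c, hc⟩ := hconst n hn
        exact ⟨c, by rw [hsmul, hc, map_add, map_smul, toD_total, Algebra.algebraMap_eq_smul_one]⟩)
    refine ⟨V ⊔ k ∙ w, IsInvariantTower.fixing N (toD k G w), fun a => ?_,
      Submodule.mem_sup_left htot, ?_, fun n hn u hu => ?_, ?_⟩
    · refine sup_le ((hst a).trans (Submodule.comap_mono le_sup_left)) ?_
      rw [Submodule.span_singleton_le_iff_mem, Submodule.mem_comap, ← sub_add_cancel
        (biregular k G a w) w]
      exact add_mem (Submodule.mem_sup_left (hfix a))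
        (Submodule.mem_sup_right (Submodule.mem_span_singleton_self w))
    · rw [Submodule.finrank_sup_span_singleton hw, hdim]
    · obtain ⟨hnN, hnw⟩ := IsInvariantTower.mem_fixing.1 hn
      obtain ⟨c, hc⟩ := hconst n hnN
      -- Fixing `t` forces `c = 0`, so `n` fixes `w` already in `V_reg`.
      rw [hsmul, hc, map_add, map_smul, toD_total, add_eq_left,
        smul_eq_zero_iff_left one_ne_zero] at hnw
      obtain ⟨v, hv, z, hz, rfl⟩ := Submodule.mem_sup.1 hu
      obtain ⟨d, hd⟩ := Submodule.mem_span_singleton.1 hz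
      rw [← hd, map_add, map_smul, hc, hnw, zero_smul, add_zero, hN n hnN v hv]
    · rw [generated_sup_singleton]
      exact hstep

end DehomSym

end

theorem theorem1p3 (p : ℕ) [Fact p.Prime] (k : Type*) [Field k] [CharP k p]
    (G : Type*) [Group G] [Finite G] (hG : IsPGroup p G) :
    Nonempty (DehomSym.invariants k G ≃ₐ[k] MvPolynomial (Fin (Nat.card G - 1)) k) ∧
      ringKrullDim (DehomSym.invariants k G) = ((Nat.card G - 1 : ℕ) : WithBot ℕ∞) := by
  have hcard : 0 < Nat.card G := Nat.card_pos
  obtain ⟨V, N, -, -, hdim, -, hT⟩ :=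
    DehomSym.exists_isInvariantTower (k := k) p hG (Nat.card G - 1) (by omega)
  -- The last stage has dimension `(|G| - 1) + 1 = |G|`.
  have hV : V = ⊤ := by
    have := Fintype.ofFinite G
    refine Submodule.eq_top_of_finrank_eq ?_
    rw [hdim, Module.finrank_finsupp_self, ← Nat.card_eq_fintype_card]
    omega
  rw [hV, DehomSym.generated_top] at hT
  obtain ⟨σ, _, f, hσ, hf, hadj⟩ := hT.polynomial
  rw [top_inf_eq] at hadj
  let e : DehomSym.invariants k G ≃ₐ[k] MvPolynomial (Fin (Nat.card G - 1)) k :=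
    ((Subalgebra.equivOfEq _ _ hadj.symm).trans hf.aevalEquiv.symm).trans
      (MvPolynomial.renameEquiv k (Fintype.equivFinOfCardEq hσ))
  refine ⟨⟨e⟩, ?_⟩
  rw [ringKrullDim_eq_of_ringEquiv e.toRingEquiv, MvPolynomial.ringKrullDim_of_isNoetherianRing,
    ringKrullDim_eq_zero_of_field, zero_add, Nat.card_fin]
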